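/- All rings are associative and need not be commutative. For a positive integer $m$ let $\mathbb{Z}[\frac1m]$ be the unital subring of $\mathbb{Q}$ generated by $\frac1m$. For a unital ring $Z$ with identity $1_Z$, a (two-sided) $Z$-ring is a ring $I$, not necessarily unital, with a $Z$-bimodule structure ($1_Z$ is not required to act as the identity on either side) such that $$z\cdot(x_1x_2)=(z\cdot x_1)x_2,\qquad x_1(z\cdot x_2)=(x_1\cdot z)x_2,\qquad (x_1x_2)\cdot z=x_1(x_2\cdot z)$$ for all $z\in Z$ and $x_1,x_2\in I$. The semidirect product $Z\ltimes I$ is the set $Z\times I$ with componentwise addition and multiplication $(z_1,x_1)(z_2,x_2)=(z_1z_2,\;z_1\cdot x_2+x_1\cdot z_2+x_1x_2)$. It is called a unital semidirect product if $I$ contains an idempotent $e$ such that $1_Z\cdot x=x-ex$ and $x\cdot 1_Z=x-xe$ for all $x\in I$; in this case it is a unital ring with identity $(1_Z,e)$. Let $R$ be an infinite unital ring, and for $a\in R$ let $\langle a\rangle_1$ be the subring of $R$ generated by $1$ and $a$. Then the set $\{\langle a\rangle_1 : a\in R\}$ is finite if and only if $R$ is isomorphic to a unital semidirect product $\mathbb{Z}[\frac1m]\ltimes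 I$ for some positive integer $m$ and some finite $\mathbb{Z}[\frac1m]$-ring $I$. -/

import Mathlib

universe u

/-- The ring `ℤ[1/m]`, as the unital subring of `ℚ` generated by `1/m`. -/
abbrev IntInv (m : ℕ) : Subring ℚ := Subring.closure {1 / (m : ℚ)}

/-- A two-sided `Z`-ring structure on a (possibly nonunital) ring `I`: a `Z`-bimodule structure
compatible with the multiplication of `I`. Even when `Z` has an identity element, it is not
required to act as the identity on `I`, on either side. -/
class TwoSidedRing (Z I : Type*) [NonUnitalRing Z] [NonUnitalRing I] where
  /-- the left action `z · x` -/
  l : Z → I → I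
  /-- the right action `x · z` -/
  r : I → Z → I
  l_add : ∀ z x y, l z (x + y) = l z x + l z y
  add_l : ∀ z w x, l (z + w) x = l z x + l w x
  mul_l : ∀ z w x, l (z * w) x = l z (l w x)
  add_r : ∀ x y z, r (x + y) z = r x z + r y z
  r_add : ∀ x z w, r x (z + w) = r x z + r x w
  r_mul : ∀ x z w, r x (z * w) = r (r x z) w
  l_r : ∀ z x w, r (l z x) w = l z (r x w)
  l_mul : ∀ z x y, l z (x * y) = l z x * y
  mul_l_eq : ∀ x z y, x * l z y = r x z * y
  mul_r : ∀ x y z, r (x * y) z = x * r y z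

/-- The underlying set of the semidirect product `Z ⋉ I`: pairs `(z, x)`. -/
@[ext]
structure RingSemidirect (Z I : Type*) where
  fst : Z
  snd : I

namespace RingSemidirect

open TwoSidedRing

section

variable {Z I : Type*} [NonUnitalRing Z] [NonUnitalRing I]

/-- The obvious bijection with the product, used to define the componentwise addition. -/
def equivProd (Z I : Type*) : RingSemidirect Z I ≃ Z × I where
  toFun a := (a.fst, a.snd)
  invFun a := ⟨a.1, a.2⟩
  left_inv _ := rfl
  right_inv _ := rfl

instance : AddCommGroup (RingSemidirect Z I) := (equivProd Z I).addCommGroup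

/-- `(z₁, x₁) (z₂, x₂) = (z₁ z₂, z₁ · x₂ + x₁ · z₂ + x₁ x₂)` -/
instance [TwoSidedRing Z I] : Mul (RingSemidirect Z I) :=
  ⟨fun a b => ⟨a.fst * b.fst, l a.fst b.snd + r a.snd b.fst + a.snd * b.snd⟩⟩

theorem fst_zero : (0 : RingSemidirect Z I).fst = 0 := rfl

theorem snd_zero : (0 : RingSemidirect Z I).snd = 0 := rfl

theorem fst_add (a b : RingSemidirect Z I) : (a + b).fst = a.fst + b.fst := rfl

theorem snd_add (a b : RingSemidirect Z I) : (a + b).snd = a.snd + b.snd := rfl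

theorem fst_mul [TwoSidedRing Z I] (a b : RingSemidirect Z I) :
    (a * b).fst = a.fst * b.fst := rfl

theorem snd_mul [TwoSidedRing Z I] (a b : RingSemidirect Z I) :
    (a * b).snd = l a.fst b.snd + r a.snd b.fst + a.snd * b.snd := rfl

theorem l_zero' [TwoSidedRing Z I] (z : Z) : l z (0 : I) = 0 := by
  have h := l_add z (0 : I) 0
  simpa using h

theorem zero_l' [TwoSidedRing Z I] (x : I) : l (0 : Z) x = 0 := by
  have h := add_l (0 : Z) 0 x
  simpa using h

theorem r_zero' [TwoSidedRing Z I] (x : I) : r x (0 : Z) = 0 := by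
  have h := r_add x (0 : Z) 0
  simpa using h

theorem zero_r' [TwoSidedRing Z I] (z : Z) : r (0 : I) z = 0 := by
  have h := add_r (0 : I) 0 z
  simpa using h

/-- The semidirect product `Z ⋉ I` is a (possibly nonunital) ring. -/
instance [TwoSidedRing Z I] : NonUnitalRing (RingSemidirect Z I) where
  left_distrib a b c := by
    ext
    · simp only [fst_mul, fst_add, mul_add]
    · simp only [fst_add, snd_mul, snd_add, mul_add, l_add, r_add]
      abel
  right_distrib a b c := by
    ext
    · simp only [fst_mul, fst_add, add_mul]
    · simp only [fst_add, snd_mul, snd_add, add_mul, add_l, add_r]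
      abel
  zero_mul a := by
    ext
    · simp only [fst_mul, fst_zero, zero_mul]
    · simp only [snd_mul, fst_zero, snd_zero, zero_mul, zero_l', zero_r', add_zero]
  mul_zero a := by
    ext
    · simp only [fst_mul, fst_zero, mul_zero]
    · simp only [snd_mul, fst_zero, snd_zero, mul_zero, l_zero', r_zero', add_zero]
  mul_assoc a b c := by
    ext
    · simp only [fst_mul, mul_assoc]
    · simp only [fst_mul, snd_mul, add_mul, mul_add, l_add, add_r, mul_l, r_mul, l_r, l_mul,
        mul_l_eq, mul_r, mul_assoc]
      abel

end

/-- `Z ⋉ I` is a unital semidirect product: `I` contains an idempotent `e` such that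
`1 · x = x - e x` and `x · 1 = x - x e` for all `x`. (Then `(1, e)` is the identity element.) -/
def IsUnital (Z I : Type*) [Ring Z] [NonUnitalRing I] [TwoSidedRing Z I] : Prop :=
  ∃ e : I, e * e = e ∧ ∀ x : I, l (1 : Z) x = x - e * x ∧ r x (1 : Z) = x - x * e

end RingSemidirect

/-! If there are finitely many ⟨a⟩₁, pigeonhole on powers of a makes a a root of an integer
polynomial with a coefficient 1. For torsion a this gives integrality, so ⟨a⟩₁ is a finitely
generated group with finite torsion; hence the torsion ideal T is finite. For general a, pigeonhole
on the multiples 2 ^ k • b of an integral multiple b of a, with Krull's intersection theorem, puts a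
nonzero multiple of a in ℤ. So R/T embeds in ℚ, with image some ℤ[1/m], and R → ℤ[1/m] splits
nonunitally: since T is finite, an inverse of a power of m can be corrected to generate a copy of
ℤ[1/m] (`exists_nonUnital_section`).

Conversely, a subring ⟨a⟩₁ is determined by its intersection with the finite kernel and one lift of
a generator of its image, and only finitely many lifts are needed. -/

open Polynomial in
/-- Modulo any positive integer, an integer polynomial with a coefficient `1` divides a monic
polynomial. -/
theorem exists_monic_mem_span_pair {P : ℤ[X]} {i : ℕ} (hP : P.coeff i = 1) (n : ℕ) :
    n ≠ 0 → ∃ Q : ℤ[X], Q.Monic ∧ Q ∈ Ideal.span {P, (n : ℤ[X])} := by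
  induction n using Nat.recOnMul with
  | zero => exact fun h => absurd rfl h
  | one => exact fun _ => ⟨1, monic_one, Ideal.subset_span (by simp)⟩
  -- The coefficient 1 keeps P nonzero over the field ℤ/p, where it can be made monic and lifted.
  | prime p hp =>
    intro _
    have : Fact p.Prime := ⟨hp⟩
    have hne : P.map (Int.castRingHom (ZMod p)) ≠ 0 := fun h => by
      simpa [hP] using congrArg (fun q => q.coeff i) h
    obtain ⟨Q, hQ, -, hmon⟩ := lifts_and_natDegree_eq_and_monic
      (f := Int.castRingHom (ZMod p)) (map_surjective _ (ZMod.ringHom_surjective _) _)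
      (monic_mul_leadingCoeff_inv hne)
    obtain ⟨c, hc⟩ := ZMod.ringHom_surjective (Int.castRingHom (ZMod p))
      (P.map (Int.castRingHom (ZMod p))).leadingCoeff⁻¹
    have hdvd : C (p : ℤ) ∣ Q - P * C c := by
      rw [C_dvd_iff_dvd_coeff]
      intro k
      have h0 : (Q - P * C c).map (Int.castRingHom (ZMod p)) = 0 := by
        rw [Polynomial.map_sub, Polynomial.map_mul, map_C, hc, hQ, sub_self]
      rw [← ZMod.intCast_zmod_eq_zero_iff_dvd, ← eq_intCast (Int.castRingHom (ZMod p)),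
        ← coeff_map, h0, coeff_zero]
    obtain ⟨D, hD⟩ := hdvd
    refine ⟨Q, hmon, Ideal.mem_span_pair.2 ⟨C c, D, ?_⟩⟩
    rw [sub_eq_iff_eq_add] at hD
    rw [hD]
    simp
    ring
  | mul a b ha hb =>
    intro hab
    obtain ⟨Q, hQ, hQm⟩ := ha (left_ne_zero_of_mul hab)
    obtain ⟨Q', hQ', hQm'⟩ := hb (right_ne_zero_of_mul hab)
    refine ⟨Q * Q', hQ.mul hQ', ?_⟩
    obtain ⟨x, y, rfl⟩ := Ideal.mem_span_pair.1 hQm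
    obtain ⟨z, w, rfl⟩ := Ideal.mem_span_pair.1 hQm'
    refine Ideal.mem_span_pair.2 ⟨x * (z * P + w * b) + y * a * z, y * w, ?_⟩
    push_cast
    ring

/-! ### Finite torsion and rationality over ℤ -/

section

variable {R : Type u} [Ring R]

open Polynomial

theorem Subring.mem_closure_singleton_iff_aeval {x y : R} :
    y ∈ Subring.closure {x} ↔ ∃ P : ℤ[X], aeval x P = y := by
  rw [← mem_subalgebraOfSubring, ← Algebra.adjoin_int, Algebra.adjoin_singleton_eq_range_aeval]
  rfl

/-- Pigeonhole gives a ^ (i+1) = P(a ^ (j+1)) with i < j. As j+1 does not divide i+1 > 0, the right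
side cannot cancel the term X ^ (i+1). -/
theorem exists_coeff_eq_one_aeval_eq_zero
    (hfin : (Set.range fun a : R => Subring.closure {a}).Finite) (a : R) :
    ∃ (P : ℤ[X]) (i : ℕ), P.coeff i = 1 ∧ aeval a P = 0 := by
  have := hfin.to_subtype
  obtain ⟨i, j, hij, h⟩ : ∃ i j : ℕ, i < j ∧
      Subring.closure {a ^ (i + 1)} = Subring.closure {a ^ (j + 1)} := by
    obtain ⟨i, j, hne, h⟩ := Finite.exists_ne_map_eq_of_infinite
      fun k : ℕ => (⟨_, a ^ (k + 1), rfl⟩ : Set.range fun a : R => Subring.closure {a})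
    have h' := congrArg Subtype.val h
    rcases lt_or_gt_of_ne hne with hlt | hlt
    · exact ⟨i, j, hlt, h'⟩
    · exact ⟨j, i, hlt, h'.symm⟩
  obtain ⟨P, hP⟩ := Subring.mem_closure_singleton_iff_aeval.1
    (h ▸ Subring.subset_closure (Set.mem_singleton _) : a ^ (i + 1) ∈ Subring.closure {a ^ (j + 1)})
  refine ⟨X ^ (i + 1) - expand ℤ (j + 1) P, i + 1, ?_, ?_⟩
  · rw [coeff_sub, coeff_X_pow, coeff_expand (Nat.succ_pos j), if_pos rfl, if_neg, sub_zero]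
    exact fun hd => absurd (Nat.le_of_dvd (Nat.succ_pos i) hd) (by omega)
  · rw [map_sub, expand_aeval, hP]
    simp

/-- The two-sided ideal of additive torsion elements, as a nonunital subring. -/
def torsionSubring (R : Type u) [Ring R] : NonUnitalSubring R where
  __ := AddCommGroup.torsion R
  mul_mem' {a b} ha _ := by
    obtain ⟨n, hn, h⟩ := isOfFinAddOrder_iff_nsmul_eq_zero.1 ha
    exact isOfFinAddOrder_iff_nsmul_eq_zero.2 ⟨n, hn, by rw [← smul_mul_assoc, h, zero_mul]⟩

theorem mem_torsionSubring {x : R} : x ∈ torsionSubring R ↔ ∃ n : ℕ, 0 < n ∧ n • x = 0 :=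
  isOfFinAddOrder_iff_nsmul_eq_zero

theorem isIntegral_of_mem_torsionSubring
    (hfin : (Set.range fun a : R => Subring.closure {a}).Finite) {t : R}
    (ht : t ∈ torsionSubring R) : IsIntegral ℤ t := by
  obtain ⟨n, hn, hnt⟩ := mem_torsionSubring.1 ht
  obtain ⟨P, i, hi, hP⟩ := exists_coeff_eq_one_aeval_eq_zero hfin t
  obtain ⟨Q, hQ, hQm⟩ := exists_monic_mem_span_pair hi n hn.ne'
  obtain ⟨x, y, rfl⟩ := Ideal.mem_span_pair.1 hQm
  -- The extra factor X is needed because n kills t but not necessarily 1.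
  refine ⟨_, hQ.mul monic_X, ?_⟩
  rw [← aeval_def, add_mul, mul_assoc y, map_add, map_mul, map_mul, map_mul, map_mul, hP]
  rw [nsmul_eq_mul] at hnt
  simp [hnt]

theorem finite_torsionSubring
    (hfin : (Set.range fun a : R => Subring.closure {a}).Finite) :
    (torsionSubring R : Set R).Finite := by
  refine (hfin.biUnion' (t := fun S _ => {x | x ∈ S ∧ x ∈ torsionSubring R ∧
    ∃ t ∈ torsionSubring R, S = Subring.closure {t}}) ?_).subset (t := (torsionSubring R : Set R)) ?_
  · rintro S -
    by_cases h : ∃ t ∈ torsionSubring R, S = Subring.closure {t}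
    swap
    · simp [h]
    obtain ⟨t, ht, rfl⟩ := h
    let A : Submodule ℤ R := Subalgebra.toSubmodule (Algebra.adjoin ℤ {t})
    have hA : Module.Finite ℤ A :=
      .of_fg (isIntegral_of_mem_torsionSubring hfin ht).fg_adjoin_singleton
    let B : Submodule ℤ A := Submodule.torsion ℤ A
    have hB : Finite B := Module.finite_of_fg_torsion B (Submodule.torsion_isTorsion)
    refine (Set.finite_range fun x : B => (x : R)).subset ?_
    rintro x ⟨hx, hxT, -⟩
    obtain ⟨n, hn, hnx⟩ := mem_torsionSubring.1 hxT
    have hxA : x ∈ A := by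
      rw [Subring.mem_closure_singleton_iff_aeval] at hx
      rw [Subalgebra.mem_toSubmodule, Algebra.adjoin_singleton_eq_range_aeval]
      exact hx
    refine ⟨⟨⟨x, hxA⟩, ?_⟩, rfl⟩
    refine (Submodule.mem_torsion_iff _).2 ⟨⟨n, mem_nonZeroDivisors_of_ne_zero (by omega)⟩, ?_⟩
    ext
    simpa using hnx
  · intro t ht
    exact Set.mem_iUnion₂.2 ⟨_, ⟨t, rfl⟩, Subring.subset_closure rfl, ht, t, ht, rfl⟩

/-- If an infinite ring has finitely many subrings `⟨a⟩₁`, it has characteristic zero. -/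
theorem charZero_of_finite_range_closure [Infinite R]
    (hfin : (Set.range fun a : R => Subring.closure {a}).Finite) : CharZero R := by
  refine charZero_of_inj_zero fun n hn => by_contra fun h0 => ?_
  refine Set.infinite_univ (α := R) ((finite_torsionSubring hfin).subset fun x _ => ?_)
  exact mem_torsionSubring.2 ⟨n, Nat.pos_of_ne_zero h0, by rw [nsmul_eq_mul, hn, zero_mul]⟩

theorem exists_eq_intCast_add_smul_of_mem_closure {b x : R} {c : ℤ}
    (hx : x ∈ Subring.closure {c • b}) :
    ∃ (z : ℤ), ∃ y ∈ Algebra.adjoin ℤ {b}, x = z + c • y := by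
  induction hx using Subring.closure_induction with
  | mem x hx => exact ⟨0, b, Algebra.subset_adjoin rfl, by simpa using hx⟩
  | zero => exact ⟨0, 0, zero_mem _, by simp⟩
  | one => exact ⟨1, 0, zero_mem _, by simp⟩
  | add x y _ _ hx hy =>
    obtain ⟨z, v, hv, rfl⟩ := hx
    obtain ⟨z', v', hv', rfl⟩ := hy
    exact ⟨z + z', v + v', add_mem hv hv', by push_cast; rw [smul_add]; abel⟩
  | neg x _ hx =>
    obtain ⟨z, v, hv, rfl⟩ := hx
    exact ⟨-z, -v, neg_mem hv, by push_cast; rw [smul_neg]; abel⟩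
  | mul x y _ _ hx hy =>
    obtain ⟨z, v, hv, rfl⟩ := hx
    obtain ⟨z', v', hv', rfl⟩ := hy
    refine ⟨z * z', z • v' + z' • v + c • (v * v'), add_mem (add_mem (zsmul_mem hv' _)
      (zsmul_mem hv _)) (zsmul_mem (mul_mem hv hv') _), ?_⟩
    simp only [zsmul_eq_mul, Int.cast_mul, mul_add, add_mul, mul_assoc]
    rw [← (Int.cast_commute z' v).eq, ← (Int.cast_commute c v).left_comm,
      (Int.cast_commute z (c : R)).left_comm]
    abel

/-- Every element of a ring with finitely many subrings `⟨a⟩₁` is rational over `ℤ`. -/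
theorem exists_zsmul_eq_intCast
    (hfin : (Set.range fun a : R => Subring.closure {a}).Finite) (a : R) :
    ∃ n k : ℤ, n ≠ 0 ∧ n • a = k := by
  obtain ⟨P, i, hi, hP⟩ := exists_coeff_eq_one_aeval_eq_zero hfin a
  obtain ⟨c, hc, hint⟩ := IsAlgebraic.exists_integral_multiple
    (⟨P, fun h => by simp [h] at hi, hP⟩ : IsAlgebraic ℤ a)
  let b := c • a
  have := hfin.to_subtype
  obtain ⟨S, hS⟩ := Finite.exists_infinite_fiber
    fun k : ℕ => (⟨_, (2 ^ k : ℤ) • b, rfl⟩ : Set.range fun a : R => Subring.closure {a})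
  have hS' := Set.infinite_coe_iff.1 hS
  obtain ⟨k, hk⟩ := hS'.nonempty
  let A : Submodule ℤ R := Subalgebra.toSubmodule (Algebra.adjoin ℤ {b})
  have hA : Module.Finite ℤ A := .of_fg hint.fg_adjoin_singleton
  have hbA : b ∈ A := Algebra.subset_adjoin rfl
  -- In ℤ[b]/ℤ the class g of 2 ^ k • b is divisible by every power of 2, since 2 ^ k • b lies in ℤ
  -- + 2 ^ j ℤ[b] for arbitrarily large j.
  let B : Submodule ℤ A := Submodule.span ℤ {⟨1, one_mem (Algebra.adjoin ℤ {b})⟩}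
  let g : A ⧸ B := B.mkQ ((2 ^ k : ℤ) • ⟨b, hbA⟩)
  have hg : g ∈ (⨅ i : ℕ, Ideal.span {(2 : ℤ)} ^ i • ⊤ : Submodule ℤ (A ⧸ B)) := by
    rw [Submodule.mem_iInf]
    intro i
    obtain ⟨j, hj, hij⟩ := hS'.exists_gt i
    have hkj : Subring.closure {(2 ^ k : ℤ) • b} = Subring.closure {(2 ^ j : ℤ) • b} :=
      congrArg Subtype.val ((show _ = S from hk).trans (show _ = S from hj).symm)
    obtain ⟨z, y, hy, hzy⟩ := exists_eq_intCast_add_smul_of_mem_closure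
      (hkj ▸ Subring.subset_closure rfl :
        (2 ^ k : ℤ) • b ∈ Subring.closure {(2 ^ j : ℤ) • b})
    have : g = (2 ^ i : ℤ) • B.mkQ ((2 ^ (j - i) : ℤ) • ⟨y, hy⟩) := by
      rw [← map_smul, smul_smul, ← pow_add, Nat.add_sub_of_le hij.le]
      refine (Submodule.Quotient.eq B).2 (Submodule.mem_span_singleton.2 ⟨z, ?_⟩)
      ext
      simp [hzy]
    rw [this, Ideal.span_singleton_pow]
    exact Submodule.smul_mem_smul (Ideal.mem_span_singleton_self _) trivial
  -- Krull's intersection theorem: g is killed by 1 - 2s, which is odd and so nonzero.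
  obtain ⟨⟨r, hr⟩, hrg⟩ := (Ideal.mem_iInf_smul_pow_eq_bot_iff _ _).1 hg
  obtain ⟨s, rfl⟩ := Ideal.mem_span_singleton.1 hr
  have h0 : B.mkQ ((1 - 2 * s : ℤ) • (2 ^ k : ℤ) • (⟨b, hbA⟩ : A)) = 0 := by
    rw [map_smul]
    change (1 - 2 * s : ℤ) • g = 0
    rw [sub_smul, one_smul, sub_eq_zero]
    exact hrg.symm
  obtain ⟨z, hz⟩ := Submodule.mem_span_singleton.1 ((Submodule.Quotient.mk_eq_zero B).1 h0)
  refine ⟨(1 - 2 * s) * 2 ^ k * c, z, ?_, ?_⟩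
  · exact mul_ne_zero (mul_ne_zero (by omega) (by positivity)) hc
  · have := congrArg Subtype.val hz
    rw [mul_smul, mul_smul]
    simpa [b] using this.symm

end

/-! ### The map to ℚ, its image and its splitting -/

section

variable {R : Type u} [Ring R]

theorem exists_ringHom_rat [CharZero R] (h : ∀ a : R, ∃ n k : ℤ, n ≠ 0 ∧ n • a = k) :
    ∃ φ : R →+* ℚ, ∀ x, φ x = 0 ↔ x ∈ torsionSubring R := by
  choose n k hn hk using h
  -- Characteristic zero makes the fraction independent of the chosen relation.
  have key {a : R} {n' k' : ℤ} (hn' : n' ≠ 0) (h : n' • a = k') :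
      (k a / n a : ℚ) = k' / n' := by
    have h1 : n' * k a = n a * k' := by
      have : ((n' * k a : ℤ) : R) = ((n a * k' : ℤ) : R) := by
        rw [Int.cast_mul, Int.cast_mul, ← hk, ← h, ← zsmul_eq_mul, ← zsmul_eq_mul, smul_comm]
      exact_mod_cast this
    have h2 : (n a : ℚ) ≠ 0 := by exact_mod_cast hn a
    have h3 : (n' : ℚ) ≠ 0 := by exact_mod_cast hn'
    rw [div_eq_div_iff h2 h3]
    exact_mod_cast (by linarith : k a * n' = k' * n a)
  have hn0 (a : R) : (n a : ℚ) ≠ 0 := by exact_mod_cast hn a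
  refine ⟨{ toFun := fun a => k a / n a, map_one' := ?_, map_mul' := ?_, map_zero' := ?_,
            map_add' := ?_ }, fun x => ?_⟩
  · simpa using key (a := (1 : R)) one_ne_zero (k' := 1) (by simp)
  · intro a b
    rw [key (a := a * b) (mul_ne_zero (hn a) (hn b)) (k' := k a * k b)
      (by rw [Int.cast_mul, ← hk, ← hk, smul_mul_smul_comm])]
    push_cast
    rw [mul_div_mul_comm]
  · simpa using key (a := (0 : R)) one_ne_zero (k' := 0) (by simp)
  · intro a b
    rw [key (a := a + b) (mul_ne_zero (hn a) (hn b)) (k' := k a * n b + n a * k b)]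
    · push_cast
      rw [div_add_div _ _ (hn0 a) (hn0 b)]
    · push_cast
      rw [← (Int.cast_commute (n b) _).eq, ← hk, ← hk, ← zsmul_eq_mul, ← zsmul_eq_mul, smul_add,
        mul_smul, mul_smul, smul_comm (n a) (n b) a]
  · change (k x / n x : ℚ) = 0 ↔ _
    rw [div_eq_zero_iff, or_iff_left (hn0 x), Int.cast_eq_zero, mem_torsionSubring]
    constructor
    · intro h0
      refine ⟨(n x).natAbs, Int.natAbs_pos.2 (hn x), ?_⟩
      rw [← natCast_zsmul, Int.natCast_natAbs]
      rcases abs_choice (n x) with h | h <;> rw [h] <;> simp [hk, h0, -zsmul_eq_mul]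
    · rintro ⟨l, hl, h⟩
      have := key (a := x) (n' := l) (k' := 0) (by omega) (by simpa using h)
      rw [Int.cast_zero, zero_div, div_eq_zero_iff, or_iff_left (hn0 x)] at this
      exact_mod_cast this

theorem Subring.one_div_den_mem {S : Subring ℚ} {x : ℚ} (hx : x ∈ S) : 1 / (x.den : ℚ) ∈ S := by
  have hb := Int.gcd_eq_gcd_ab x.num x.den
  rw [show Int.gcd x.num x.den = 1 from x.reduced] at hb
  have hd : (x.den : ℚ) ≠ 0 := by exact_mod_cast x.den_ne_zero
  have : 1 / (x.den : ℚ) = x * (Int.gcdA x.num x.den : ℤ) + (Int.gcdB x.num x.den : ℤ) := by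
    have hb' : (1 : ℚ) = x.num * (Int.gcdA x.num x.den : ℤ) +
      x.den * (Int.gcdB x.num x.den : ℤ) := by exact_mod_cast hb
    nth_rw 2 [← Rat.num_div_den x]
    rw [eq_comm, eq_div_iff hd]
    rw [add_mul, div_mul_eq_mul_div, div_mul_cancel₀ _ hd, hb']
    ring
  rw [this]
  exact add_mem (mul_mem hx (intCast_mem S _)) (intCast_mem S _)

theorem Subring.one_div_mem_of_dvd {S : Subring ℚ} {a b : ℕ} (hb : b ≠ 0) (hab : a ∣ b)
    (h : 1 / (b : ℚ) ∈ S) : 1 / (a : ℚ) ∈ S := by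
  obtain ⟨c, rfl⟩ := hab
  have ha : (a : ℚ) ≠ 0 := by exact_mod_cast left_ne_zero_of_mul hb
  have hc : (c : ℚ) ≠ 0 := by exact_mod_cast right_ne_zero_of_mul hb
  have : 1 / (a : ℚ) = c * (1 / ((a * c : ℕ) : ℚ)) := by
    push_cast
    field_simp
  rw [this]
  exact mul_mem (natCast_mem S c) h

theorem Subring.mem_of_one_div_den_mem {S : Subring ℚ} {x : ℚ} (h : 1 / (x.den : ℚ) ∈ S) :
    x ∈ S := by
  rw [← Rat.num_div_den x, div_eq_mul_one_div]
  exact mul_mem (intCast_mem S _) h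

theorem closure_singleton_eq_closure_one_div_den (x : ℚ) :
    Subring.closure {x} = Subring.closure {1 / (x.den : ℚ)} := by
  apply le_antisymm <;> rw [Subring.closure_le, Set.singleton_subset_iff]
  · exact Subring.mem_of_one_div_den_mem (Subring.subset_closure rfl)
  · exact Subring.one_div_den_mem (Subring.subset_closure rfl)

/-- Each ⟨x⟩₁ is generated by the reciprocal of the denominator of x, so the product of the
denominators of finitely many representatives serves as m. -/
theorem exists_eq_intInv_of_finite (D : Subring ℚ)
    (h : ((fun x : ℚ => Subring.closure {x}) '' (D : Set ℚ)).Finite) :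
    ∃ m : ℕ, 0 < m ∧ D = IntInv m := by
  classical
  obtain ⟨F, hFD, hF⟩ := Finset.subset_set_image_iff.1 h.coe_toFinset.subset
  refine ⟨∏ x ∈ F, x.den, Finset.prod_pos fun x _ => x.den_pos, le_antisymm (fun x hx => ?_) ?_⟩
  · have hxF : Subring.closure {x} ∈ F.image fun x : ℚ => Subring.closure {x} := by
      rw [hF, Set.Finite.mem_toFinset]
      exact ⟨x, hx, rfl⟩
    obtain ⟨y, hy, hyx⟩ := Finset.mem_image.1 hxF
    have hy' : y ∈ IntInv (∏ x ∈ F, x.den) :=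
      Subring.mem_of_one_div_den_mem (Subring.one_div_mem_of_dvd
        (Finset.prod_ne_zero_iff.2 fun x _ => x.den_ne_zero) (Finset.dvd_prod_of_mem _ hy)
        (Subring.subset_closure rfl))
    have hle : Subring.closure {y} ≤ IntInv (∏ x ∈ F, x.den) := by
      rwa [Subring.closure_le, Set.singleton_subset_iff]
    exact hle (hyx ▸ Subring.subset_closure rfl)
  · rw [Subring.closure_le, Set.singleton_subset_iff, Nat.cast_prod, one_div,
      ← Finset.prod_inv_distrib]
    exact prod_mem fun x hx => by simpa using Subring.one_div_den_mem (hFD hx)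

open Polynomial in
theorem exists_mul_mul_self_eq (M : ℤ) (v : R)
    (h : (M ^ 2) • (M • v - 1) = M • (M • v - 1)) (φ : R →+* ℚ) (hv : M * φ v = 1) :
    ∃ w : R, M • (w * w) = w ∧ M * φ w = 1 := by
  -- With M an indeterminate, W becomes 0 at M = 0, 1 at M = 1, and X when MX = 1. In each case MW²
  -- = W, so M(M - 1)(MX - 1) divides MW² - W.
  let W : ℤ[X] := C M * (1 + X + X ^ 2 - C M * X - C M * X ^ 2)
  have hW : C M * (W * W) - W = (C (M ^ 2) * (C M * X - 1) - C M * (C M * X - 1)) *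
      -((1 + C M * (X + 1)) * (1 + X + X ^ 2 - C M * X - C M * X ^ 2)) := by
    simp only [W, C_pow]
    ring
  refine ⟨aeval v W, ?_, ?_⟩
  · have h0 : aeval v (C (M ^ 2) * (C M * X - 1) - C M * (C M * X - 1)) = 0 := by
      simpa only [map_sub, map_mul, map_one, aeval_X, eq_intCast, map_intCast,
        zsmul_eq_mul, sub_eq_zero] using h
    have h1 : aeval v (C M * (W * W) - W) = 0 := by rw [hW, map_mul, h0, zero_mul]
    rw [map_sub, map_mul _ (C M), map_mul _ W W, aeval_C, sub_eq_zero] at h1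
    simpa only [algebraMap_int_eq, eq_intCast, zsmul_eq_mul] using h1
  · simp only [W, map_mul, map_add, map_sub, map_one, map_pow, aeval_X, eq_intCast, map_intCast]
    linear_combination (-M ^ 2 * (1 + φ v) + M * φ v + 1) * hv

theorem exists_pow_sq_eq_pow {M : Type*} [Monoid M] [Finite M] (a : M) :
    ∃ s : ℕ, 0 < s ∧ (a ^ s) ^ 2 = a ^ s := by
  obtain ⟨i, p, hp, h⟩ : ∃ i p : ℕ, 0 < p ∧ a ^ i = a ^ (i + p) := by
    obtain ⟨i, j, hne, h⟩ := Finite.exists_ne_map_eq_of_infinite fun k : ℕ => a ^ k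
    rcases lt_or_gt_of_ne hne with hlt | hlt
    · exact ⟨i, j - i, by omega, by rw [Nat.add_sub_of_le hlt.le]; exact h⟩
    · exact ⟨j, i - j, by omega, by rw [Nat.add_sub_of_le hlt.le]; exact h.symm⟩
  have step (l n : ℕ) (hn : i ≤ n) : a ^ (n + l * p) = a ^ n := by
    induction l with
    | zero => simp
    | succ l ih =>
      rw [← ih, show n + (l + 1) * p = (i + p) + (n - i + l * p) by
          have : (l + 1) * p = l * p + p := Nat.succ_mul l p
          omega, pow_add, ← h, ← pow_add]
      congr 1
      omega
  -- A multiple of the period p that is past the preperiod i.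
  refine ⟨(i + 1) * p, Nat.mul_pos i.succ_pos hp, ?_⟩
  rw [← pow_mul, mul_two]
  exact step _ _ (by nlinarith)

theorem exists_pow_smul_idempotent {T : Type*} [AddCommGroup T] [Finite T] (m : ℤ) :
    ∃ s : ℕ, 0 < s ∧ ∀ x : T, ((m ^ s) ^ 2) • x = (m ^ s) • x := by
  have : NeZero (Nat.card T) := ⟨Nat.card_pos.ne'⟩
  obtain ⟨s, hs, h⟩ := exists_pow_sq_eq_pow (m : ZMod (Nat.card T))
  refine ⟨s, hs, fun x => ?_⟩
  have h' : (((m ^ s) ^ 2 - m ^ s : ℤ) : ZMod (Nat.card T)) = 0 := by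
    push_cast
    rw [h, sub_self]
  obtain ⟨c, hc⟩ := (ZMod.intCast_zmod_eq_zero_iff_dvd _ _).1 h'
  rw [← sub_eq_zero, ← sub_smul, hc, mul_comm, mul_smul, natCast_zsmul, card_nsmul_eq_zero',
    smul_zero]

/-- A surjection onto `ℤ[1/m]` whose kernel is finite splits as a map of nonunital rings. -/
theorem exists_nonUnital_section {m : ℕ} (hm : 0 < m) (φ : R →+* ℚ)
    (hφ : φ.range = IntInv m) (hker : Finite (RingHom.ker φ)) :
    ∃ σ : IntInv m →ₙ+* R, ∀ z, φ (σ z) = z := by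
  have hm0 : (m : ℚ) ≠ 0 := by exact_mod_cast hm.ne'
  obtain ⟨s, hs, hidem⟩ := exists_pow_smul_idempotent (T := RingHom.ker φ) (m : ℤ)
  obtain ⟨u, hu⟩ : ∃ u, φ u = 1 / m := by
    rw [← RingHom.mem_range, hφ]
    exact Subring.subset_closure rfl
  let M : ℤ := m ^ s
  have hM0 : (M : ℚ) ≠ 0 := by simp [M, hm0]
  have hv : (M : ℚ) * φ (u ^ s) = 1 := by simp [M, hu, hm0]
  obtain ⟨w, hw, hφw⟩ := exists_mul_mul_self_eq M (u ^ s) (by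
    have hmem : M • u ^ s - 1 ∈ RingHom.ker φ := by
      rw [RingHom.mem_ker, map_sub, map_zsmul, zsmul_eq_mul, hv, map_one, sub_self]
    exact congrArg Subtype.val (hidem ⟨_, hmem⟩)) φ hv
  have hφw' : φ w = 1 / M := by
    rw [eq_div_iff hM0, mul_comm, hφw]
  have hpow (j i : ℕ) : w ^ (j + 1) = M ^ i • w ^ (j + 1 + i) := by
    induction i with
    | zero => simp
    | succ i ih =>
      rw [ih, pow_succ M, mul_smul, show j + 1 + (i + 1) = j + i + 2 by ring, pow_add w (j + i), sq,
        ← mul_smul_comm, hw, ← pow_succ, add_right_comm]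
  -- The fractions k / M ^ (j+1), with w in the role of 1/M. The exponent is positive because the
  -- identity here is M • w, not 1.
  let S₀ : NonUnitalSubring R :=
    { carrier := {x | ∃ (k : ℤ) (j : ℕ), x = k • w ^ (j + 1)}
      zero_mem' := ⟨0, 0, by simp⟩
      neg_mem' := by
        rintro _ ⟨k, j, rfl⟩
        exact ⟨-k, j, by rw [neg_smul]⟩
      add_mem' := by
        rintro _ _ ⟨k, j, rfl⟩ ⟨l, i, rfl⟩
        refine ⟨k * M ^ (i + 1) + l * M ^ (j + 1), j + 1 + i, ?_⟩
        rw [hpow j (i + 1), hpow i (j + 1), add_smul, smul_smul, smul_smul,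
          show i + 1 + (j + 1) = j + 1 + (i + 1) by ring, add_assoc (j + 1)]
      mul_mem' := by
        rintro _ _ ⟨k, j, rfl⟩ ⟨l, i, rfl⟩
        refine ⟨k * l, j + 1 + i, ?_⟩
        rw [smul_mul_smul_comm, ← pow_add]
        rfl }
  have hwS : w ∈ S₀ := ⟨1, 0, by simp⟩
  let f : S₀ →ₙ+* IntInv m :=
    { toFun := fun x => ⟨φ x, hφ ▸ ⟨_, rfl⟩⟩
      map_zero' := by ext; simp
      map_add' := fun x y => by ext; simp
      map_mul' := fun x y => by ext; simp }
  have hinj : Function.Injective f := by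
    rw [injective_iff_map_eq_zero]
    rintro ⟨_, k, j, rfl⟩ h
    have h' : φ (k • w ^ (j + 1)) = 0 := congrArg Subtype.val h
    rw [map_zsmul, map_pow, hφw', zsmul_eq_mul, mul_eq_zero, or_iff_left
      (pow_ne_zero _ (one_div_ne_zero hM0)), Int.cast_eq_zero] at h'
    ext
    simp [h']
  have hsurj : Function.Surjective f := by
    suffices h : ∀ z ∈ IntInv m, ∃ x ∈ S₀, φ x = z by
      rintro ⟨z, hz⟩
      obtain ⟨x, hx, rfl⟩ := h z hz
      exact ⟨⟨x, hx⟩, rfl⟩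
    intro z hz
    induction hz using Subring.closure_induction with
    | mem x hx =>
      refine ⟨(m ^ (s - 1) : ℤ) • w, zsmul_mem hwS _, ?_⟩
      rw [Set.mem_singleton_iff.1 hx, map_zsmul, hφw', zsmul_eq_mul]
      obtain ⟨s, rfl⟩ := Nat.exists_eq_succ_of_ne_zero hs.ne'
      simp only [M, Nat.succ_eq_add_one, Nat.add_sub_cancel, pow_succ]
      push_cast
      field_simp
    | zero => exact ⟨0, zero_mem _, map_zero _⟩
    | one => exact ⟨M • w, zsmul_mem hwS _, by rw [map_zsmul, zsmul_eq_mul, hφw]⟩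
    | add x y _ _ hx hy =>
      obtain ⟨x, hx, rfl⟩ := hx
      obtain ⟨y, hy, rfl⟩ := hy
      exact ⟨x + y, add_mem hx hy, map_add _ _ _⟩
    | neg x _ hx =>
      obtain ⟨x, hx, rfl⟩ := hx
      exact ⟨-x, neg_mem hx, map_neg _ _⟩
    | mul x y _ _ hx hy =>
      obtain ⟨x, hx, rfl⟩ := hx
      obtain ⟨y, hy, rfl⟩ := hy
      exact ⟨x * y, mul_mem hx hy, map_mul _ _ _⟩
  let E := RingEquiv.ofBijective f ⟨hinj, hsurj⟩
  refine ⟨(NonUnitalSubringClass.subtype S₀).comp (E.symm : IntInv m →ₙ+* S₀), fun z => ?_⟩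
  exact congrArg Subtype.val (E.apply_symm_apply z)

end

/-! ### Assembling the semidirect product -/

section
variable {R : Type u} [Ring R]

/-- A nonunital splitting `σ` of `R → ℤ[1/m]` makes the torsion ideal a two-sided `ℤ[1/m]`-ring. -/
@[reducible]
def twoSidedRingOfSection {m : ℕ} (σ : IntInv m →ₙ+* R) {φ : R →+* ℚ}
    (hφ : ∀ x, φ x = 0 ↔ x ∈ torsionSubring R) : TwoSidedRing (IntInv m) (torsionSubring R) where
  l z x := ⟨σ z * x, (hφ _).1 (by rw [map_mul, (hφ x).2 x.2, mul_zero])⟩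
  r x z := ⟨x * σ z, (hφ _).1 (by rw [map_mul, (hφ x).2 x.2, zero_mul])⟩
  l_add _ _ _ := Subtype.ext (mul_add _ _ _)
  add_l _ _ _ := Subtype.ext (by simp [add_mul])
  mul_l _ _ _ := Subtype.ext (by simp [mul_assoc])
  add_r _ _ _ := Subtype.ext (add_mul _ _ _)
  r_add _ _ _ := Subtype.ext (by simp [mul_add])
  r_mul _ _ _ := Subtype.ext (by simp [mul_assoc])
  l_r _ _ _ := Subtype.ext (mul_assoc _ _ _)
  l_mul _ _ _ := Subtype.ext (mul_assoc _ _ _).symm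
  mul_l_eq _ _ _ := Subtype.ext (mul_assoc _ _ _).symm
  mul_r _ _ _ := Subtype.ext (mul_assoc _ _ _)

theorem exists_ringSemidirect_of_finite_range_closure [Infinite R]
    (hfin : (Set.range fun a : R => Subring.closure {a}).Finite) :
    ∃ (m : ℕ) (_ : 0 < m) (I : Type u) (_ : NonUnitalRing I) (_ : Finite I)
        (_ : TwoSidedRing (IntInv m) I),
        RingSemidirect.IsUnital (IntInv m) I ∧
          Nonempty (R ≃+* RingSemidirect (IntInv m) I) := by
  have := charZero_of_finite_range_closure hfin
  obtain ⟨φ, hφ⟩ := exists_ringHom_rat (exists_zsmul_eq_intCast hfin)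
  have hT : Finite (torsionSubring R) := (finite_torsionSubring hfin).to_subtype
  obtain ⟨m, hm, hrange⟩ := exists_eq_intInv_of_finite φ.range (by
    refine (hfin.image (Subring.map φ)).subset ?_
    rintro _ ⟨_, ⟨a, rfl⟩, rfl⟩
    refine ⟨_, ⟨a, rfl⟩, ?_⟩
    simp [RingHom.map_closure])
  obtain ⟨σ, hσ⟩ := exists_nonUnital_section hm φ hrange
    (((finite_torsionSubring hfin).subset fun x hx => (hφ x).1 hx).to_subtype)
  let := twoSidedRingOfSection σ hφ
  refine ⟨m, hm, torsionSubring R, inferInstance, hT, inferInstance, ?_, ⟨?_⟩⟩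
  -- The idempotent e measures the failure of σ to be unital.
  · refine ⟨⟨1 - σ 1, (hφ _).1 ?_⟩, Subtype.ext ?_, fun x => ⟨Subtype.ext ?_, Subtype.ext ?_⟩⟩
    · rw [map_sub, map_one, hσ]
      exact sub_self _
    · have : σ 1 * σ 1 = σ 1 := by rw [← map_mul, one_mul]
      simp [mul_sub, sub_mul, this]
    · change σ 1 * (x : R) = x - (1 - σ 1) * x
      rw [sub_mul, one_mul, sub_sub_cancel]
    · change (x : R) * σ 1 = x - x * (1 - σ 1)
      rw [mul_sub, mul_one, sub_sub_cancel]
  · refine RingEquiv.symm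
      { toFun := fun p => σ p.fst + p.snd
        invFun := fun a => ⟨⟨φ a, hrange ▸ ⟨a, rfl⟩⟩, ⟨a - σ ⟨φ a, hrange ▸ ⟨a, rfl⟩⟩,
          (hφ _).1 (by rw [map_sub, hσ, sub_self])⟩⟩
        left_inv := ?_
        right_inv := fun a => by simp
        map_mul' := ?_
        map_add' := ?_ }
    · rintro ⟨z, x⟩
      have hz : φ (σ z + x) = z := by rw [map_add, hσ, (hφ x).2 x.2, add_zero]
      ext
      · exact hz
      · simp [hz]
    · intro p q
      change σ (p.fst * q.fst) + (σ p.fst * (q.snd : R) + p.snd * σ q.fst + p.snd * q.snd) = _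
      rw [map_mul]
      noncomm_ring
    · intro p q
      change σ (p.fst + q.fst) + ((p.snd : R) + q.snd) = _
      rw [map_add]
      abel

/-! ### The converse: counting the subrings ⟨a⟩₁ -/

theorem exists_dvd_pow_den {m : ℕ} (hm : 0 < m) {x : ℚ} (hx : x ∈ IntInv m) :
    ∃ n : ℕ, x.den ∣ m ^ n := by
  induction hx using Subring.closure_induction with
  | mem x hx =>
    rw [Set.mem_singleton_iff.1 hx]
    exact ⟨1, by simp [hm.ne']⟩
  | zero => exact ⟨0, by simp⟩
  | one => exact ⟨0, by simp⟩
  | neg x _ hx => simpa using hx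
  | add x y _ _ hx hy =>
    obtain ⟨a, ha⟩ := hx
    obtain ⟨b, hb⟩ := hy
    exact ⟨a + b, (Rat.add_den_dvd x y).trans (pow_add m a b ▸ mul_dvd_mul ha hb)⟩
  | mul x y _ _ hx hy =>
    obtain ⟨a, ha⟩ := hx
    obtain ⟨b, hb⟩ := hy
    exact ⟨a + b, (Rat.mul_den_dvd x y).trans (pow_add m a b ▸ mul_dvd_mul ha hb)⟩

open UniqueFactorizationMonoid in
-- Only the primes in the denominator matter; passing to its radical leaves finitely many candidates
-- r.
theorem exists_dvd_closure_eq_intInv {m : ℕ} (hm : 0 < m) {x : ℚ} (hx : x ∈ IntInv m) :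
    ∃ r : ℕ, r ∣ m ∧ Subring.closure {x} = IntInv r := by
  refine ⟨radical x.den, (exists_dvd_pow_iff_radical_dvd x.den_ne_zero).1
    (exists_dvd_pow_den hm hx), ?_⟩
  rw [closure_singleton_eq_closure_one_div_den]
  apply le_antisymm <;> rw [Subring.closure_le, Set.singleton_subset_iff]
  · obtain ⟨n, hn⟩ := exists_dvd_radical_self_pow x.den_ne_zero
    refine Subring.one_div_mem_of_dvd (pow_ne_zero n radical_ne_zero) hn ?_
    rw [Nat.cast_pow, ← one_div_pow]
    exact pow_mem (Subring.subset_closure (Set.mem_singleton _)) n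
  · exact Subring.one_div_mem_of_dvd x.den_ne_zero radical_dvd_self
      (Subring.subset_closure (Set.mem_singleton _))

/-- A subring S = ⟨a⟩₁ with image ℤ[1/r] is generated by any y ∈ S over 1/r together with S ∩ ker φ.
Fibres of φ are finite, so there are finitely many such pairs. -/
theorem finite_range_closure_of_finite_ker {m : ℕ} (hm : 0 < m) (φ : R →+* ℚ)
    (hφ : ∀ x, φ x ∈ IntInv m) (hker : {x | φ x = 0}.Finite) :
    (Set.range fun a : R => Subring.closure {a}).Finite := by
  have hfib (q : ℚ) : (φ ⁻¹' {q}).Finite := by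
    rcases (φ ⁻¹' {q}).eq_empty_or_nonempty with h | ⟨y, hy⟩
    · simp [h]
    · refine (hker.image (y + ·)).subset fun x hx => ⟨x - y, ?_, add_sub_cancel _ _⟩
      rw [Set.mem_preimage, Set.mem_singleton_iff] at hx hy
      simp [hx, hy]
  have hY : (⋃ r ∈ (m.divisors : Set ℕ), φ ⁻¹' {1 / (r : ℚ)}).Finite :=
    m.divisors.finite_toSet.biUnion fun r _ => hfib _
  refine ((hY.prod hker.finite_subsets).image
    fun p : R × Set R => Subring.closure (insert p.1 p.2)).subset ?_
  rintro _ ⟨a, rfl⟩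
  obtain ⟨r, hrm, hr⟩ := exists_dvd_closure_eq_intInv hm (hφ a)
  have hmap : (Subring.closure {a}).map φ = IntInv r := by
    rw [RingHom.map_closure, Set.image_singleton, hr]
  obtain ⟨y, hy, hyr⟩ : 1 / (r : ℚ) ∈ (Subring.closure {a}).map φ :=
    hmap ▸ Subring.subset_closure rfl
  refine ⟨(y, {x | x ∈ Subring.closure {a} ∧ φ x = 0}), ⟨?_, fun x hx => hx.2⟩,
    le_antisymm ?_ fun x hx => ?_⟩
  · exact Set.mem_biUnion (Finset.mem_coe.2 (Nat.mem_divisors.2 ⟨hrm, hm.ne'⟩)) hyr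
  · rw [Subring.closure_le]
    exact Set.insert_subset hy fun x hx => hx.1
  · obtain ⟨c, hc, hcx⟩ : φ x ∈ (Subring.closure {y}).map φ := by
      rw [RingHom.map_closure, Set.image_singleton, show φ y = 1 / r from hyr]
      exact hmap.le ⟨x, hx, rfl⟩
    rw [← add_sub_cancel c x]
    refine add_mem (Subring.closure_mono (by simp) hc)
      (Subring.subset_closure (Or.inr ⟨sub_mem hx ?_, ?_⟩))
    · exact (Subring.closure_le.2 (Set.singleton_subset_iff.2 hy)) hc
    · rw [map_sub, ← hcx]
      exact sub_self _

theorem finite_range_closure_of_ringEquiv {m : ℕ} (hm : 0 < m) {I : Type*} [NonUnitalRing I]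
    [Finite I] [TwoSidedRing (IntInv m) I] (E : R ≃+* RingSemidirect (IntInv m) I) :
    (Set.range fun a : R => Subring.closure {a}).Finite := by
  have hone : ((E 1).fst : ℚ) = 1 := by
    -- The target carries only a nonunital ring structure, so the first coordinate of E 1 is found
    -- by multiplying with (1, 0).
    have h : E 1 * ⟨1, 0⟩ = ⟨1, 0⟩ := by
      rw [← E.apply_symm_apply ⟨1, 0⟩, ← map_mul, one_mul]
    have h' := congrArg RingSemidirect.fst h
    rw [RingSemidirect.fst_mul, mul_one] at h'
    simp [h']
  refine finite_range_closure_of_finite_ker hm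
    { toFun := fun a => ((E a).fst : ℚ)
      map_one' := hone
      map_zero' := by rw [map_zero]; rfl
      map_add' := fun a b => by rw [map_add]; rfl
      map_mul' := fun a b => by rw [map_mul]; rfl } (fun x => (E x).fst.2) ?_
  refine Set.Finite.of_finite_image (f := fun x => (E x).snd) (Set.toFinite _) ?_
  intro x hx y hy hxy
  refine E.injective (RingSemidirect.ext (Subtype.ext ?_) hxy)
  exact (show ((E x).fst : ℚ) = 0 from hx).trans (show ((E y).fst : ℚ) = 0 from hy).symm

end

theorem corollary5p6 {R : Type u} [Ring R] [Infinite R] :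
    (Set.range fun a : R => Subring.closure {a}).Finite ↔
      ∃ (m : ℕ) (_ : 0 < m) (I : Type u) (_ : NonUnitalRing I) (_ : Finite I)
        (_ : TwoSidedRing (IntInv m) I),
        RingSemidirect.IsUnital (IntInv m) I ∧
          Nonempty (R ≃+* RingSemidirect (IntInv m) I) := by
  refine ⟨exists_ringSemidirect_of_finite_range_closure, ?_⟩
  rintro ⟨m, hm, I, _, _, _, -, ⟨E⟩⟩
  exact finite_range_closure_of_ringEquiv hm E
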